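/- Let $\kappa$ be an infinite cardinal, let $L$ be a first-order language with at most $\kappa$ symbols, and let $M$ be an $L$-structure with $|M|\le\kappa$. Let $\mathcal U\succeq M$ be a monster model, by which we only mean a $\kappa^+$-saturated elementary extension of $M$. Let $x,y$ be finite tuples of variables and let $\phi(x;y)$ be an $L$-formula that is NIP, i.e. there do not exist in $\mathcal U$ an infinite set $A$ of $|x|$-tuples and, for each $I\subseteq A$, a $|y|$-tuple $b_I$ such that for all $a\in A$: $\mathcal U\models\phi(a;b_I)$ if and only if $a\in I$. Let $S_\phi(\mathcal U)$ be the space of global $\phi$-types, i.e. of maximal sets of formulas $\phi(x;b)$, $\neg\phi(x;b)$ (with $b$ a $|y|$-tuple from $\mathcal U$) that are finitely satisfiable in $\mathcal U$, with the topology generated by the sets $\{p : \phi(x;b)\in p\}$ and $\{p : \neg\phi(x;b)\in p\}$. Let $\mathrm{Inv}_\phi(M)\subseteq S_\phi(\mathcal U)$ be the set of $M$-invariant types: those $p$ such that $\phi(x;b)\in p \iff \phi(x;b')\in p$ whenever $b,b'$ have the same complete type over $M$. Let $Z\subseteq \mathrm{Inv}_\phi(M)$ be any subset and let $p\in\overline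 Z$. Then there is a subset $Z_0\subseteq Z$ of cardinality at most $\kappa$ such that $p\in\overline{Z_0}$. -/

import Mathlib

open FirstOrder Cardinal

universe u v w

namespace LocalType

variable {L : FirstOrder.Language.{u, v}} {U : Type w} [L.Structure U]

/-- `U` is `μ`-saturated: over every parameter set `A` with fewer than `μ` elements, each set of
formulas in one variable that is finitely satisfiable in `U` is realized in `U`. -/
def IsSaturated (L : FirstOrder.Language.{u, v}) (U : Type w) [L.Structure U]
    (μ : Cardinal.{w}) : Prop :=
  ∀ A : Set U, #A < μ → ∀ S : Set (L[[A]].Formula (Fin 1)),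
    (∀ s : Finset (L[[A]].Formula (Fin 1)), (s : Set (L[[A]].Formula (Fin 1))) ⊆ S →
      ∃ c : Fin 1 → U, ∀ ψ ∈ s, ψ.Realize c) →
    ∃ c : Fin 1 → U, ∀ ψ ∈ S, ψ.Realize c

/-- The tuples `b` and `b'` have the same complete type over the parameter set `A`. -/
def SameTypeOver (L : FirstOrder.Language.{u, v}) {U : Type w} [L.Structure U]
    (A : Set U) {n : ℕ} (b b' : Fin n → U) : Prop :=
  ∀ ψ : L[[A]].Formula (Fin n), ψ.Realize b ↔ ψ.Realize b'

/-- The formula `φ(x; y)` is NIP in `U`: no infinite set of `x`-tuples has all its subsets cut out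
by instances of `φ`. -/
def IsNIP (U : Type w) [L.Structure U] {m n : ℕ} (φ : L.Formula (Fin m ⊕ Fin n)) : Prop :=
  ¬ ∃ A : Set (Fin m → U), A.Infinite ∧
    ∀ I ⊆ A, ∃ b : Fin n → U, ∀ a ∈ A, φ.Realize (Sum.elim a b) ↔ a ∈ I

/-- A (complete) `φ`-type over `U`, i.e. a maximal consistent set of formulas `φ(x; b)`,
`¬ φ(x; b)` with `b` in `U`. It is recorded by the set `pos` of all `b` such that `φ(x; b)` belongs
to the type; for the other `b` it contains `¬ φ(x; b)`. Consistency means that every finite part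
is satisfied in `U`. -/
@[ext]
structure PhiType (U : Type w) [L.Structure U] {m n : ℕ}
    (φ : L.Formula (Fin m ⊕ Fin n)) where
  /-- The parameters `b` such that `φ(x; b)` belongs to the type. -/
  pos : Set (Fin n → U)
  consistent : ∀ s : Finset (Fin n → U), ∃ a : Fin m → U,
    ∀ b ∈ s, φ.Realize (Sum.elim a b) ↔ b ∈ pos

/-- The topology on the space of `φ`-types generated by the sets of types containing
a given formula `φ(x; b)` or `¬ φ(x; b)`. -/
instance PhiType.instTopologicalSpace {m n : ℕ} (φ : L.Formula (Fin m ⊕ Fin n)) :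
    TopologicalSpace (PhiType U φ) :=
  TopologicalSpace.generateFrom
    (Set.range (fun b : Fin n → U => {p : PhiType U φ | b ∈ p.pos}) ∪
      Set.range (fun b : Fin n → U => {p : PhiType U φ | b ∉ p.pos}))

/-- The set of `A`-invariant `φ`-types over `U`: whether `φ(x; b)` belongs to the type depends only
on the type of `b` over `A`. -/
def Inv (A : Set U) {m n : ℕ} (φ : L.Formula (Fin m ⊕ Fin n)) : Set (PhiType U φ) :=
  {p | ∀ b b' : Fin n → U, SameTypeOver L A b b' → (b ∈ p.pos ↔ b' ∈ p.pos)}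

end LocalType

/-! View a φ-type as a truth-valued function of `b`, and give parameter tuples the topology of
`M`-definable sets, which has a base of size at most κ. NIP makes an invariant φ-type q nearly
continuous. Extend q to an ultrafilter, take a generic sequence for it, and let the rank of `b`
measure how long φ(·, b) can alternate on tuples with the type over `M` of an initial segment. The
last value of a longest alternation is the value of q at `b`, since a further term with the value of
q would otherwise prolong it. By compactness the rank cannot increase nearby, and q is constant
nearby on tuples of equal rank (`exists_rank`). So q has a continuity point on every nonempty set of
finite families of parameters (`exists_continuity_point`).

For the closure (`exists_small_agreeing`), fix a pattern η; call B bad for Y ⊆ Z if p has pattern η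
at B and no member of Y does. Choose a small Z₀ without bad points in each basic open set where some
small subset of Z has none. If the set D of its bad points is nonempty, every larger small subset of
Z still has bad points in each basic open set meeting D. Pick a point of D in each of these sets,
and members of Z with pattern η at finitely many of the picked points. Their ultrafilter limit g has
pattern η at every picked point, but at no point that is bad once those members are added to Z₀. So
g has no continuity point on D, although it is invariant. -/

namespace LocalType

variable {L : FirstOrder.Language.{u, v}} {U : Type w} [L.Structure U]

/-! ### Definable sets and compactness in a saturated structure -/

theorem definable_realize {α β : Type*} (A : Set U) (φ : L.Formula β) (f : β → α) :
    A.Definable L {v : α → U | φ.Realize (v ∘ f)} := by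
  have h : (∅ : Set U).Definable L (Set.ofPred φ.Realize) :=
    Set.empty_definable_iff.2 ⟨φ, rfl⟩
  exact (h.preimage_comp f).mono (Set.empty_subset A)

/-- Substituting parameters for some of the coordinates of a definable set. -/
theorem definable_fiber {α β : Type*} {A B : Set U} {S : Set (α ⊕ β → U)}
    (hS : A.Definable L S) (v : α → U) (hAB : A ⊆ B) (hv : Set.range v ⊆ B) :
    B.Definable L {t : β → U | Sum.elim v t ∈ S} := by
  rw [Set.definable_iff_exists_formula_sum] at hS ⊢
  obtain ⟨ψ, rfl⟩ := hS
  let g : A ⊕ (α ⊕ β) → B ⊕ β :=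
    Sum.elim (fun a => Sum.inl ⟨a, hAB a.2⟩)
      (Sum.elim (fun i => Sum.inl ⟨v i, hv ⟨i, rfl⟩⟩) Sum.inr)
  refine ⟨ψ.relabel g, ?_⟩
  ext t
  simp only [Set.mem_ofPred_eq, Language.Formula.realize_relabel]
  refine iff_of_eq (congrArg _ ?_)
  ext (a | i | j) <;> rfl

theorem mk_union_range_le {κ : Cardinal.{w}} (hκ : ℵ₀ ≤ κ) {A : Set U} (hA : #A ≤ κ)
    {α : Type*} [Finite α] (v : α → U) : #(A ∪ Set.range v : Set U) ≤ κ :=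
  (mk_union_le _ _).trans (add_le_of_le hκ hA ((Set.finite_range v).lt_aleph0.le.trans hκ))

/-- In a saturated structure, a directed family of nonempty definable sets of finite tuples, over
a small set of parameters, has a common point. -/
theorem IsSaturated.exists_forall_mem {κ : Cardinal.{w}} (hκ : ℵ₀ ≤ κ)
    (hU : IsSaturated L U (Order.succ κ)) {α : Type} [Finite α] {ι : Type*} [Nonempty ι]
    {A : Set U} (hA : #A ≤ κ) {F : ι → Set (α → U)} (hdir : Directed (· ⊇ ·) F)
    (hdef : ∀ i, A.Definable L (F i)) (hne : ∀ i, (F i).Nonempty) :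
    ∃ x, ∀ i, x ∈ F i := by
  have main : ∀ (α : Type) [Finite α] (A : Set U), #A ≤ κ → ∀ F : ι → Set (α → U),
      Directed (· ⊇ ·) F → (∀ i, A.Definable L (F i)) → (∀ i, (F i).Nonempty) →
      ∃ x, ∀ i, x ∈ F i := by
    clear! α A
    intro α _
    induction α using Finite.induction_empty_option with
    | of_equiv e ih =>
      intro A hA F hdir hdef hne
      obtain ⟨x, hx⟩ := ih A hA (fun i => {t | t ∘ e.symm ∈ F i})
        (fun i j => by
          obtain ⟨k, hi, hj⟩ := hdir i j
          exact ⟨k, fun t ht => hi ht, fun t ht => hj ht⟩)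
        (fun i => (hdef i).preimage_comp e.symm)
        (fun i => by
          obtain ⟨t, ht⟩ := hne i
          exact ⟨t ∘ e, by simpa [Function.comp_assoc] using ht⟩)
      exact ⟨_, hx⟩
    | h_empty =>
      intro A hA F hdir hdef hne
      refine ⟨fun i => i.elim, fun i => ?_⟩
      obtain ⟨t, ht⟩ := hne i
      convert ht using 1
      exact funext fun j => j.elim
    | h_option ih =>
      rename_i α _
      intro A hA F hdir hdef hne
      -- One coordinate at a time: saturation gives a common point `c` of the projections to the new
      -- coordinate, and `c` then joins the parameters for the remaining coordinates.
      let P : ι → Set (Fin 1 → U) := fun i => (fun t => t ∘ (fun _ => none)) '' F i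
      have hP : ∀ i, ∃ ψ : L[[A]].Formula (Fin 1), P i = Set.ofPred ψ.Realize :=
        fun i => (hdef i).image_comp (fun _ : Fin 1 => (none : Option α))
      choose ψ hψ using hP
      obtain ⟨c, hc⟩ := hU A (Order.lt_succ_of_le hA) (Set.range ψ) (fun s hs => by
        classical
        choose g hg using fun x : s => hs x.2
        obtain ⟨k, hk⟩ := hdir.finset_le (Finset.univ.image g)
        obtain ⟨t, ht⟩ := hne k
        refine ⟨t ∘ fun _ => none, fun χ hχ => ?_⟩
        have h1 : t ∈ F (g ⟨χ, hχ⟩) := hk _ (Finset.mem_image_of_mem _ (Finset.mem_univ _)) ht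
        have h2 : (t ∘ fun _ : Fin 1 => none) ∈ P (g ⟨χ, hχ⟩) := ⟨t, h1, rfl⟩
        rw [hψ, Set.mem_ofPred_eq, hg] at h2
        exact h2)
      have hc' : ∀ i, c ∈ P i := fun i => by
        rw [hψ]
        exact hc _ ⟨i, rfl⟩
      let e : Option α → Fin 1 ⊕ α := fun o => o.elim (Sum.inl 0) Sum.inr
      obtain ⟨x, hx⟩ := ih (A ∪ Set.range c)
        (mk_union_range_le hκ hA c)
        (fun i => {t | Sum.elim c t ∈ {v : Fin 1 ⊕ α → U | v ∘ e ∈ F i}})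
        (fun i j => by
          obtain ⟨k, hi, hj⟩ := hdir i j
          exact ⟨k, fun t ht => hi ht, fun t ht => hj ht⟩)
        (fun i => definable_fiber ((hdef i).preimage_comp e) c Set.subset_union_left
          Set.subset_union_right)
        (fun i => by
          obtain ⟨t, ht, rfl⟩ := hc' i
          refine ⟨t ∘ some, ?_⟩
          simp only [Set.mem_ofPred_eq]
          convert ht using 1
          ext (_ | o) <;> rfl)
      exact ⟨_, hx⟩
  exact main α A hA F hdir hdef hne

/-! ### Equality of types and homogeneity -/

/-- Two tuples belong to the same `A`-definable sets. -/
def SameDef (L : FirstOrder.Language.{u, v}) {U : Type w} [L.Structure U]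
    (A : Set U) {α : Type*} (v v' : α → U) : Prop :=
  ∀ S : Set (α → U), A.Definable L S → (v ∈ S ↔ v' ∈ S)

namespace SameDef
variable {A : Set U} {α β : Type*} {v v' v'' : α → U}

theorem symm (h : SameDef L A v v') : SameDef L A v' v := fun S hS => (h S hS).symm

theorem trans (h : SameDef L A v v') (h' : SameDef L A v' v'') : SameDef L A v v'' :=
  fun S hS => (h S hS).trans (h' S hS)

theorem comp (h : SameDef L A v v') (f : β → α) : SameDef L A (v ∘ f) (v' ∘ f) :=
  fun _ hS => h _ (hS.preimage_comp f)

theorem realize_iff (h : SameDef L A v v') (φ : L.Formula β) (f : β → α) :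
    φ.Realize (v ∘ f) ↔ φ.Realize (v' ∘ f) :=
  h _ (definable_realize A φ f)

theorem of_forall_imp (h : ∀ S : Set (α → U), A.Definable L S → v ∈ S → v' ∈ S) :
    SameDef L A v v' :=
  fun S hS => ⟨h S hS, fun hv' => by_contra fun hv => h _ hS.compl hv hv'⟩

end SameDef

theorem sameTypeOver_iff {A : Set U} {n : ℕ} {b b' : Fin n → U} :
    SameTypeOver L A b b' ↔ SameDef L A b b' := by
  constructor
  · rintro h S ⟨ψ, rfl⟩
    exact h ψ
  · intro h ψ
    exact h _ ⟨ψ, rfl⟩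

/-- Homogeneity of saturated structures. -/
theorem IsSaturated.exists_sameDef {κ : Cardinal.{w}} (hκ : ℵ₀ ≤ κ)
    (hU : IsSaturated L U (Order.succ κ)) {α β : Type} [Finite α] [Finite β]
    {A : Set U} (hA : #A ≤ κ) {v v' : α → U} (h : SameDef L A v v') (t : β → U) :
    ∃ t' : β → U, SameDef L A (Sum.elim v t) (Sum.elim v' t') := by
  let ι := {S : Set (α ⊕ β → U) // A.Definable L S ∧ Sum.elim v t ∈ S}
  have : Nonempty ι := ⟨⟨Set.univ, Set.definable_univ, trivial⟩⟩
  obtain ⟨t', ht'⟩ := hU.exists_forall_mem hκ (mk_union_range_le hκ hA v') (ι := ι)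
    (F := fun S => {t' | Sum.elim v' t' ∈ S.1})
    (fun S T => ⟨⟨S.1 ∩ T.1, S.2.1.inter T.2.1, S.2.2, T.2.2⟩, fun _ hx => hx.1, fun _ hx => hx.2⟩)
    (fun S => definable_fiber S.2.1 v' Set.subset_union_left Set.subset_union_right)
    (fun S => by
      -- The projection of `S` to the first coordinates is `A`-definable and contains `v`, hence
      -- `v'`.
      obtain ⟨s, hs, hs'⟩ := (h _ (S.2.1.image_comp Sum.inl)).1 ⟨_, S.2.2, rfl⟩
      refine ⟨s ∘ Sum.inr, ?_⟩
      rw [Set.mem_ofPred_eq, ← hs']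
      convert hs using 1
      ext (i | i) <;> rfl)
  exact ⟨t', SameDef.of_forall_imp fun S hS hv => ht' ⟨S, hS, hv⟩⟩

/-! ### Ramsey's theorem -/

/-- Ramsey's theorem for colourings of increasing tuples of natural numbers. -/
theorem exists_strictMono_homogeneous {C : Type*} [Finite C] (k : ℕ) (c : (Fin k → ℕ) → C) :
    ∃ f : ℕ → ℕ, StrictMono f ∧ ∃ x, ∀ t : Fin k → ℕ, StrictMono t → c (f ∘ t) = x := by
  induction k with
  | zero => exact ⟨id, strictMono_id, c Fin.elim0, fun t _ => congrArg c (Subsingleton.elim _ _)⟩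
  | succ k ih =>
    -- A nonprincipal ultrafilter gives each `k`-tuple the colour of almost all its prolongations.
    -- Along a sparse sequence every prolongation has this colour, which leaves a colouring of
    -- `k`-tuples.
    have h1 : ∀ s : Fin k → ℕ, ∃ x, ∀ᶠ i in (Filter.hyperfilter ℕ : Filter ℕ),
        c (Fin.snoc s i) = x := fun s => by
      obtain ⟨x, hx⟩ := Ultrafilter.eq_pure_of_finite
        ((Filter.hyperfilter ℕ).map fun i => c (Fin.snoc s i))
      refine ⟨x, ?_⟩
      have : {x} ∈ (Filter.hyperfilter ℕ).map fun i => c (Fin.snoc s i) := by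
        rw [hx]
        exact rfl
      exact this
    choose c' hc' using h1
    have h2 : ∀ n, ∃ x, n < x ∧ ∀ s : Fin k → ℕ, (∀ i, s i ≤ n) → c (Fin.snoc s x) = c' s := by
      intro n
      have hfin : {s : Fin k → ℕ | ∀ i, s i ≤ n}.Finite :=
        Set.Finite.pi' fun _ : Fin k => Set.finite_le_nat n
      have h3 := (Filter.eventually_all_finite hfin).2 (fun s _ => hc' s)
      have h4 : ∀ᶠ i in (Filter.hyperfilter ℕ : Filter ℕ), n < i :=
        Nat.hyperfilter_le_atTop (Filter.eventually_gt_atTop n)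
      exact (h4.and h3).exists
    choose g hg hgc using h2
    let f : ℕ → ℕ := fun n => Nat.rec (g 0) (fun _ x => g x) n
    have hf : StrictMono f := strictMono_nat_of_lt_succ fun n => hg (f n)
    have hfc : ∀ (s : Fin k → ℕ) (n : ℕ), (∀ i, s i < n) →
        c (Fin.snoc (f ∘ s) (f n) : Fin (k + 1) → ℕ) = c' (f ∘ s) := by
      intro s n hs
      cases n with
      | zero => exact hgc 0 _ fun i => absurd (hs i) (by simp)
      | succ n => exact hgc _ _ fun i => hf.monotone (Nat.lt_succ_iff.1 (hs i))
    obtain ⟨h, hh, x, hx⟩ := ih (fun s => c' (f ∘ s))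
    refine ⟨f ∘ h, hf.comp hh, x, fun t ht => ?_⟩
    rw [← hx (Fin.init t) (fun i j hij => ht (Fin.castSucc_lt_castSucc_iff.2 hij)),
      ← hfc (h ∘ Fin.init t) (h (t (Fin.last k))) (fun i => hh (ht (Fin.castSucc_lt_last i)))]
    refine congrArg c (funext fun i => ?_)
    cases i using Fin.lastCases <;> simp [Fin.init]

variable {m n : ℕ}

/-! ### NIP: shattering and alternation -/

/-- The first `N` terms of the sequence `c` are shattered by the instances of `φ`. -/
def Shatters (φ : L.Formula (Fin m ⊕ Fin n)) (N : ℕ) (c : ℕ → Fin m → U) : Prop :=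
  ∀ η : ℕ → Prop, ∃ b : Fin n → U, ∀ i < N, φ.Realize (Sum.elim (c i) b) ↔ η i

theorem Shatters.mono {φ : L.Formula (Fin m ⊕ Fin n)} {N K : ℕ} {c : ℕ → Fin m → U}
    (h : Shatters φ N c) (hK : K ≤ N) : Shatters φ K c := fun η => by
  obtain ⟨b, hb⟩ := h η
  exact ⟨b, fun i hi => hb i (hi.trans_le hK)⟩

/-- The set of pairs of `k` many `x`-tuples and a `y`-tuple at which `φ` has a prescribed pattern is
definable. -/
theorem definable_pattern (A : Set U) (φ : L.Formula (Fin m ⊕ Fin n)) {k : ℕ} (η : Fin k → Prop) :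
    A.Definable L {v : (Fin k × Fin m) ⊕ Fin n → U |
      ∀ i, φ.Realize (Sum.elim (fun j => v (Sum.inl (i, j))) (fun j => v (Sum.inr j))) ↔ η i} := by
  have h : ∀ i, A.Definable L {v : (Fin k × Fin m) ⊕ Fin n → U |
      φ.Realize (Sum.elim (fun j => v (Sum.inl (i, j))) (fun j => v (Sum.inr j))) ↔ η i} := by
    intro i
    have h0 := definable_realize A φ (Sum.map (fun j => (i, j)) id :
      Fin m ⊕ Fin n → (Fin k × Fin m) ⊕ Fin n)
    have e : ∀ v : (Fin k × Fin m) ⊕ Fin n → U,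
        v ∘ (Sum.map (fun j => (i, j)) id : Fin m ⊕ Fin n → (Fin k × Fin m) ⊕ Fin n) =
        Sum.elim (fun j => v (Sum.inl (i, j))) (fun j => v (Sum.inr j)) :=
      fun v => funext fun x => by cases x <;> rfl
    simp only [e] at h0
    by_cases hη : η i
    · simpa [hη] using h0
    · simpa [hη, Set.compl_ofPred] using h0.compl
  simpa only [Set.ofPred_forall] using Set.definable_iInter_of_finite h

theorem definable_shatters (A : Set U) (φ : L.Formula (Fin m ⊕ Fin n)) (N : ℕ) :
    A.Definable L {v : Fin N × Fin m → U | ∀ η : Fin N → Prop, ∃ b : Fin n → U, ∀ i,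
      φ.Realize (Sum.elim (fun j => v (i, j)) b) ↔ η i} := by
  have h := Set.definable_iInter_of_finite
    fun η : Fin N → Prop => (definable_pattern A φ η).exists_of_finite
  convert h using 1
  ext v
  simp only [Set.mem_iInter]
  rfl

/-- If arbitrarily long finite sequences extending the first `k` terms of `c` are shattered, then
the next term can be chosen such that this remains true. -/
theorem IsSaturated.exists_update {κ : Cardinal.{w}} (hκ : ℵ₀ ≤ κ)
    (hU : IsSaturated L U (Order.succ κ)) {φ : L.Formula (Fin m ⊕ Fin n)} {k : ℕ} {c : ℕ → Fin m → U}
    (h : ∀ N, ∃ c' : ℕ → Fin m → U, (∀ i < k, c' i = c i) ∧ Shatters φ N c') :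
    ∃ x : Fin m → U, ∀ N, ∃ c' : ℕ → Fin m → U,
      (∀ i < k, c' i = c i) ∧ c' k = x ∧ Shatters φ N c' := by
  let v : Fin k × Fin m → U := fun x => c x.1 x.2
  have hA : #(Set.range v) ≤ κ := (Set.finite_range v).lt_aleph0.le.trans hκ
  refine hU.exists_forall_mem hκ hA (F := fun N : ℕ => {x | ∃ c' : ℕ → Fin m → U,
      (∀ i < k, c' i = c i) ∧ c' k = x ∧ Shatters φ N c'}) ?_ ?_ ?_
  · refine directed_of_isDirected_le fun N K hNK x => ?_
    rintro ⟨c', h1, h2, h3⟩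
    exact ⟨c', h1, h2, h3.mono hNK⟩
  · intro N
    have h1 := definable_shatters (Set.range v) φ N
    -- The window must contain both the `N` shattered terms and the index `k`, whichever reaches
    -- further.
    let K := N + (k + 1)
    let e1 : Fin N × Fin m → Fin K × Fin m := Prod.map (Fin.castLE (by omega)) id
    let e2 : (Fin k × Fin m) ⊕ Fin m → Fin K × Fin m :=
      Sum.elim (Prod.map (Fin.castLE (by omega)) id) (fun j => (⟨k, by omega⟩, j))
    have h2 := definable_fiber ((h1.preimage_comp e1).image_comp e2) v subset_rfl subset_rfl
    convert h2 using 1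
    ext x
    constructor
    · rintro ⟨c', hc, rfl, hs⟩
      refine ⟨fun y => c' y.1 y.2, fun η => ?_, ?_⟩
      · obtain ⟨b, hb⟩ := hs (fun i => ∃ hi : i < N, η ⟨i, hi⟩)
        exact ⟨b, fun i => (hb i i.2).trans (by simp)⟩
      · ext (⟨i, j⟩ | j)
        · simp [e2, v, hc i i.2]
        · rfl
    · rintro ⟨w, hw, hwe⟩
      refine ⟨fun i => if hi : i < K then fun j => w (⟨i, hi⟩, j) else fun j => x j, ?_, ?_, ?_⟩
      · intro i hi
        have : i < K := by omega
        ext j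
        simpa [this, e2, v] using congrFun hwe (Sum.inl (⟨i, hi⟩, j))
      · have : k < K := by omega
        ext j
        simpa [this, e2, v] using congrFun hwe (Sum.inr j)
      · intro η
        obtain ⟨b, hb⟩ := hw (fun i => η i)
        refine ⟨b, fun i hi => ?_⟩
        have : i < K := by omega
        simpa [this, e1] using hb ⟨i, hi⟩
  · intro N
    obtain ⟨c', h1, h2⟩ := h N
    exact ⟨_, c', h1, rfl, h2⟩

/-- Otherwise an infinite sequence is built term by term, always keeping arbitrarily long shattered
continuations, and saturation yields a parameter for each subset of its range. -/
theorem IsNIP.exists_not_shatters {κ : Cardinal.{w}} (hκ : ℵ₀ ≤ κ)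
    (hU : IsSaturated L U (Order.succ κ)) {φ : L.Formula (Fin m ⊕ Fin n)} (hφ : IsNIP U φ) :
    ∃ N, ∀ c : ℕ → Fin m → U, ¬ Shatters φ N c := by
  by_contra! H
  apply hφ
  let P : ℕ → (ℕ → Fin m → U) → Prop := fun k c =>
    ∀ N, ∃ c' : ℕ → Fin m → U, (∀ i < k, c' i = c i) ∧ Shatters φ N c'
  have step : ∀ k c, P k c → ∃ c₁, P (k + 1) c₁ ∧ ∀ i < k, c₁ i = c i := by
    intro k c h
    obtain ⟨x, hx⟩ := hU.exists_update hκ h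
    refine ⟨Function.update c k x, fun N => ?_, fun i hi => Function.update_of_ne hi.ne _ _⟩
    obtain ⟨c', h1, h2, h3⟩ := hx N
    refine ⟨c', fun i hi => ?_, h3⟩
    rcases (Nat.lt_succ_iff_lt_or_eq.1 hi) with hi | rfl
    · rw [Function.update_of_ne hi.ne, h1 i hi]
    · rw [Function.update_self, h2]
  choose! g hg hgc using step
  obtain ⟨c₀, -⟩ := H 0
  let s : ℕ → ℕ → Fin m → U := fun k => Nat.rec c₀ g k
  have hs : ∀ k, P k (s k) := fun k => by
    induction k with
    | zero => exact fun N => (H N).imp fun c hc => ⟨by simp, hc⟩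
    | succ k ih => exact hg k _ ih
  have hsc : ∀ i k, i < k → s k i = s (i + 1) i := fun i k hik => by
    induction k, hik using Nat.le_induction with
    | base => rfl
    | succ k hk ih => rw [← ih]; exact hgc k _ (hs k) i hk
  let c : ℕ → Fin m → U := fun i => s (i + 1) i
  have hc : ∀ N, Shatters φ N c := fun N => by
    obtain ⟨c', h1, h2⟩ := hs N N
    intro η
    obtain ⟨b, hb⟩ := h2 η
    refine ⟨b, fun i hi => ?_⟩
    rw [← hb i hi, h1 i hi, hsc i N hi]
  have hinj : Function.Injective c := fun i j hij => by
    obtain ⟨b, hb⟩ := hc (max i j + 1) (fun x => x = i)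
    have h1 := hb i (by omega)
    have h2 := hb j (by omega)
    rw [← hij] at h2
    exact (h2.1 (h1.2 rfl)).symm
  refine ⟨Set.range c, Set.infinite_range_of_injective hinj, fun I _ => ?_⟩
  let A : Set U := ⋃ i, Set.range (c i)
  have hA : #A ≤ κ :=
    (Set.countable_iUnion fun i => (Set.finite_range (c i)).countable).le_aleph0.trans hκ
  obtain ⟨b, hb⟩ := hU.exists_forall_mem hκ hA (F := fun N : ℕ => {b : Fin n → U |
      ∀ i : Fin N, φ.Realize (Sum.elim (c i) b) ↔ c i ∈ I})
    (directed_of_isDirected_le fun N K hNK b hb i => hb (Fin.castLE hNK i))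
    (fun N => definable_fiber (definable_pattern A φ fun i : Fin N => c i ∈ I)
      (fun x => c x.1 x.2) subset_rfl (by
        rintro _ ⟨x, rfl⟩
        exact Set.mem_iUnion.2 ⟨x.1, x.2, rfl⟩))
    (fun N => by
      obtain ⟨b, hb⟩ := hc N (fun i => c i ∈ I)
      exact ⟨b, fun i => hb i i.2⟩)
  refine ⟨b, ?_⟩
  rintro _ ⟨i, rfl⟩
  exact hb (i + 1) (Fin.last i)

/-- For a NIP formula, every sequence has a subsequence on which no instance of the formula
alternates too often. -/
theorem IsNIP.exists_strictMono_not_alternating {κ : Cardinal.{w}} (hκ : ℵ₀ ≤ κ)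
    (hU : IsSaturated L U (Order.succ κ)) {φ : L.Formula (Fin m ⊕ Fin n)} (hφ : IsNIP U φ)
    (a : ℕ → Fin m → U) : ∃ f : ℕ → ℕ, StrictMono f ∧ ∃ K : ℕ, ∀ (s : Prop) (b : Fin n → U),
      ¬ ∀ i < K, φ.Realize (Sum.elim (a (f i)) b) ↔ (Even i ↔ s) := by
  obtain ⟨N, hN⟩ := hφ.exists_not_shatters hκ hU
  obtain ⟨f, hf, P, hP⟩ := exists_strictMono_homogeneous N
    (fun (t : Fin N → ℕ) (η : Fin N → Prop) =>
      ∃ b : Fin n → U, ∀ i, φ.Realize (Sum.elim (a (t i)) b) ↔ η i)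
  refine ⟨f, hf, 2 * N, fun s b hb => hN (a ∘ f) fun η => ?_⟩
  classical
  -- Each pair of indices 2i, 2i+1 offers both truth values, and `t` picks the one prescribed by η.
  -- Homogeneity moves the pattern from `t` to the first `N` terms.
  let t : Fin N → ℕ := fun i => 2 * i + if η i ↔ s then 0 else 1
  have ht : StrictMono t := fun i j hij => by
    have : (i : ℕ) < j := hij
    simp only [t]
    split_ifs <;> omega
  have h1 := (hP t ht).trans (hP (fun i => (i : ℕ)) fun i j hij => hij).symm
  have h2 := congrFun h1 (fun i => η i)
  obtain ⟨b', hb'⟩ := h2.mp ⟨b, fun i => by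
    have hlt : t i < 2 * N := by
      have := i.2
      simp only [t]
      split_ifs <;> omega
    refine (hb (t i) hlt).trans ?_
    by_cases h : η i ↔ s
    · simp [t, h]
    · have : ¬ Even (2 * (i : ℕ) + 1) := by simp
      simp only [t, h, if_false, this]
      tauto⟩
  exact ⟨b', fun i hi => hb' ⟨i, hi⟩⟩

/-! ### Generic sequences of an invariant φ-type -/

/-- A `φ`-type extends to an ultrafilter on the `x`-tuples. -/
theorem PhiType.exists_ultrafilter {φ : L.Formula (Fin m ⊕ Fin n)} (p : PhiType U φ) :
    ∃ G : Ultrafilter (Fin m → U),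
      ∀ b, {a | φ.Realize (Sum.elim a b) ↔ b ∈ p.pos} ∈ G := by
  let F : Filter (Fin m → U) := ⨅ b, Filter.principal {a | φ.Realize (Sum.elim a b) ↔ b ∈ p.pos}
  have hF : F.NeBot := by
    rw [Filter.neBot_iff, Ne, ← Filter.empty_mem_iff_bot]
    intro h
    obtain ⟨s, hs⟩ := (Filter.mem_iInf_finite _).1 h
    rw [Filter.iInf_principal_finset] at hs
    obtain ⟨a, ha⟩ := p.consistent s
    exact hs (Set.mem_iInter₂.2 ha)
  obtain ⟨G, hG⟩ := Ultrafilter.exists_le F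
  exact ⟨G, fun b => hG (Filter.mem_iInf_of_mem b (Filter.mem_principal_self _))⟩

/-- The sequence `a` realizes the ultrafilter `G` generically: `a k` lies in every set of `G` that is
definable over `A k`, where `A k` contains the previous terms. -/
structure IsGenericSeq (L : FirstOrder.Language.{u, v}) {U : Type w} [L.Structure U]
    (G : Ultrafilter (Fin m → U)) (A : ℕ → Set U) (a : ℕ → Fin m → U) : Prop where
  mono : Monotone A
  range_subset : ∀ k, Set.range (a k) ⊆ A (k + 1)
  mem : ∀ k, ∀ S ∈ G, (A k).Definable L S → a k ∈ S

theorem IsGenericSeq.comp {G : Ultrafilter (Fin m → U)} {A : ℕ → Set U} {a : ℕ → Fin m → U}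
    (h : IsGenericSeq L G A a) {f : ℕ → ℕ} (hf : StrictMono f) :
    IsGenericSeq L G (A ∘ f) (a ∘ f) where
  mono := h.mono.comp hf.monotone
  range_subset k := (h.range_subset (f k)).trans (h.mono (hf (Nat.lt_succ_self k)))
  mem k := h.mem (f k)

theorem IsGenericSeq.range_subset_of_lt {G : Ultrafilter (Fin m → U)} {A : ℕ → Set U}
    {a : ℕ → Fin m → U} (h : IsGenericSeq L G A a) {i k : ℕ} (hik : i < k) :
    Set.range (a i) ⊆ A k :=
  (h.range_subset i).trans (h.mono hik)

theorem IsSaturated.exists_generic {κ : Cardinal.{w}} (hκ : ℵ₀ ≤ κ)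
    (hU : IsSaturated L U (Order.succ κ)) (G : Ultrafilter (Fin m → U)) {A : Set U} (hA : #A ≤ κ) :
    ∃ c : Fin m → U, ∀ S ∈ G, A.Definable L S → c ∈ S := by
  let ι := {S : Set (Fin m → U) // S ∈ G ∧ A.Definable L S}
  have : Nonempty ι := ⟨⟨Set.univ, Filter.univ_mem, Set.definable_univ⟩⟩
  obtain ⟨c, hc⟩ := hU.exists_forall_mem hκ hA (ι := ι) (F := Subtype.val)
    (fun S T => ⟨⟨S.1 ∩ T.1, Filter.inter_mem S.2.1 T.2.1, S.2.2.inter T.2.2⟩,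
      Set.inter_subset_left, Set.inter_subset_right⟩)
    (fun S => S.2.2) (fun S => G.nonempty_of_mem S.2.1)
  exact ⟨c, fun S hS hd => hc ⟨S, hS, hd⟩⟩

theorem IsSaturated.exists_isGenericSeq {κ : Cardinal.{w}} (hκ : ℵ₀ ≤ κ)
    (hU : IsSaturated L U (Order.succ κ)) (G : Ultrafilter (Fin m → U)) {M : Set U} (hM : #M ≤ κ) :
    ∃ A a, M ⊆ A 0 ∧ IsGenericSeq L G A a := by
  have h : ∀ A : Set U, ∃ c : Fin m → U, #A ≤ κ → ∀ S ∈ G, A.Definable L S → c ∈ S := fun A => by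
    by_cases hA : #A ≤ κ
    · exact (hU.exists_generic hκ G hA).imp fun c hc _ => hc
    · obtain ⟨c, -⟩ := G.nonempty_of_mem Filter.univ_mem
      exact ⟨c, fun h => absurd h hA⟩
  choose g hg using h
  let A : ℕ → Set U := fun k => Nat.rec M (fun _ B => B ∪ Set.range (g B)) k
  have hA : ∀ k, #↥(A k) ≤ κ := fun k => by
    induction k with
    | zero => exact hM
    | succ k ih => exact mk_union_range_le hκ ih _
  exact ⟨A, fun k => g (A k), subset_rfl, monotone_nat_of_le_succ fun k => Set.subset_union_left,
    fun k => Set.subset_union_right, fun k => hg _ (hA k)⟩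

/-- The first `k` terms of a sequence, as one tuple. -/
def initTuple (k : ℕ) (a : ℕ → Fin m → U) : Fin k × Fin m → U := fun x => a x.1 x.2

/-- Tuples with the type of the first `k` terms of a generic sequence can be prolonged to tuples
with the type of the first `k + 1` terms such that the new term agrees with the given invariant
`φ`-type at a given parameter. -/
theorem IsGenericSeq.exists_extension {κ : Cardinal.{w}} (hκ : ℵ₀ ≤ κ)
    (hU : IsSaturated L U (Order.succ κ)) {φ : L.Formula (Fin m ⊕ Fin n)} {M : Set U} (hM : #M ≤ κ)
    {p : PhiType U φ} (hp : p ∈ Inv M φ) {G : Ultrafilter (Fin m → U)}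
    (hG : ∀ b, {a | φ.Realize (Sum.elim a b) ↔ b ∈ p.pos} ∈ G) {A : ℕ → Set U} {a : ℕ → Fin m → U}
    (h : IsGenericSeq L G A a) (hMA : M ⊆ A 0) {k : ℕ} {a' : ℕ → Fin m → U}
    (ha' : SameDef L M (initTuple k a) (initTuple k a')) (b : Fin n → U) :
    ∃ c, SameDef L M (initTuple (k + 1) a) (initTuple (k + 1) (Function.update a' k c)) ∧
      (φ.Realize (Sum.elim c b) ↔ b ∈ p.pos) := by
  -- Only `p` is invariant, `G` need not be. So `b` is moved to the side of `a`, a generic `c` is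
  -- taken there over `b'`, and `c` is moved back by homogeneity.
  obtain ⟨b', hb'⟩ := hU.exists_sameDef hκ hM ha'.symm b
  obtain ⟨c, hc⟩ := hU.exists_generic hκ G
    (mk_union_range_le hκ (mk_union_range_le hκ hM (initTuple k a)) b')
  have hbb' : SameDef L M b b' := hb'.comp Sum.inr
  have hcb' : φ.Realize (Sum.elim c b') ↔ b' ∈ p.pos := by
    refine hc _ (hG b') ?_
    have h1 : M.Definable L {v : Fin n ⊕ Fin m → U |
        φ.Realize (v ∘ (Sum.swap : Fin m ⊕ Fin n → Fin n ⊕ Fin m))} := definable_realize M φ _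
    have h2 := definable_fiber (B := (M ∪ Set.range (initTuple k a)) ∪ Set.range b') h1 b'
      (Set.subset_union_left.trans Set.subset_union_left) Set.subset_union_right
    have e : ∀ t : Fin m → U, Sum.elim b' t ∘ (Sum.swap : Fin m ⊕ Fin n → Fin n ⊕ Fin m) =
        Sum.elim t b' := fun t => funext fun x => by cases x <;> rfl
    simp only [Set.mem_ofPred_eq, e] at h2
    by_cases hb : b' ∈ p.pos
    · simpa [hb] using h2
    · simpa [hb, Set.compl_ofPred] using h2.compl
  -- Both `a k` and `c` realize `G` over `M` and the first `k` terms.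
  have hca : SameDef L M (Sum.elim (initTuple k a) (a k)) (Sum.elim (initTuple k a) c) := by
    have key : ∀ S, M.Definable L S → {t | Sum.elim (initTuple k a) t ∈ S} ∈ G →
        Sum.elim (initTuple k a) (a k) ∈ S ∧ Sum.elim (initTuple k a) c ∈ S := fun S hS hSG =>
      ⟨h.mem k _ hSG (definable_fiber hS _ (hMA.trans (h.mono k.zero_le)) (by
          rintro _ ⟨x, rfl⟩
          exact h.range_subset_of_lt x.1.2 ⟨x.2, rfl⟩)),
        hc _ hSG (definable_fiber hS _ (Set.subset_union_left.trans Set.subset_union_left)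
          (Set.subset_union_right.trans Set.subset_union_left))⟩
    intro S hS
    rcases G.mem_or_compl_mem {t | Sum.elim (initTuple k a) t ∈ S} with hSG | hSG
    · exact iff_of_true (key S hS hSG).1 (key S hS hSG).2
    · exact iff_of_false (key Sᶜ hS.compl hSG).1 (key Sᶜ hS.compl hSG).2
  obtain ⟨c', hc'⟩ := hU.exists_sameDef hκ hM hb'.symm c
  refine ⟨c', ?_, ?_⟩
  · have h1 : SameDef L M (Sum.elim (initTuple k a) c) (Sum.elim (initTuple k a') c') := by
      convert hc'.comp (Sum.map Sum.inl id) using 1 <;> ext (x | x) <;> rfl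
    let e : Fin (k + 1) × Fin m → (Fin k × Fin m) ⊕ Fin m := fun x =>
      if hx : (x.1 : ℕ) < k then Sum.inl (⟨x.1, hx⟩, x.2) else Sum.inr x.2
    convert (hca.trans h1).comp e using 1
    · ext ⟨i, j⟩
      by_cases hi : (i : ℕ) < k
      · simp [e, hi, initTuple]
      · have : (i : ℕ) = k := by omega
        simp [e, initTuple, this]
    · ext ⟨i, j⟩
      by_cases hi : (i : ℕ) < k
      · simp [e, hi, initTuple, hi.ne]
      · have : (i : ℕ) = k := by omega
        simp [e, initTuple, this]
  · have h1 := hc'.realize_iff φ (Sum.elim Sum.inr (Sum.inl ∘ Sum.inr))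
    have e1 : ∀ (x : Fin k × Fin m → U) (y : Fin n → U) (z : Fin m → U),
        Sum.elim (Sum.elim x y) z ∘ (Sum.elim Sum.inr (Sum.inl ∘ Sum.inr) :
          Fin m ⊕ Fin n → ((Fin k × Fin m) ⊕ Fin n) ⊕ Fin m) = Sum.elim z y :=
      fun x y z => funext fun i => by cases i <;> rfl
    rw [e1, e1] at h1
    exact h1.symm.trans (hcb'.trans (hp _ _ (sameTypeOver_iff.2 hbb')).symm)

/-! ### The alternation rank -/

/-- Some tuple with the same type over `M` as the first `k` terms of `a` is such that `φ(·, b)`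
alternates on it. -/
def Alternates (M : Set U) (φ : L.Formula (Fin m ⊕ Fin n)) (a : ℕ → Fin m → U) (k : ℕ) (s : Prop)
    (b : Fin n → U) : Prop :=
  ∃ a' : ℕ → Fin m → U, SameDef L M (initTuple k a) (initTuple k a') ∧
    ∀ i < k, φ.Realize (Sum.elim (a' i) b) ↔ (Even i ↔ s)

theorem exists_definable_not_alternates {κ : Cardinal.{w}} (hκ : ℵ₀ ≤ κ)
    (hU : IsSaturated L U (Order.succ κ)) {φ : L.Formula (Fin m ⊕ Fin n)} {M : Set U} (hM : #M ≤ κ)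
    {a : ℕ → Fin m → U} {k : ℕ} {s : Prop} {b : Fin n → U} (hb : ¬ Alternates M φ a k s b) :
    ∃ θ, M.Definable L θ ∧ b ∈ θ ∧ ∀ b' ∈ θ, ¬ Alternates M φ a k s b' := by
  by_contra! H
  apply hb
  let ι := {S : Set (Fin k × Fin m → U) // M.Definable L S ∧ initTuple k a ∈ S}
  have : Nonempty ι := ⟨⟨Set.univ, Set.definable_univ, trivial⟩⟩
  let P : Set ((Fin k × Fin m) ⊕ Fin n → U) := {v | ∀ i : Fin k,
    φ.Realize (Sum.elim (fun j => v (Sum.inl (i, j))) (fun j => v (Sum.inr j))) ↔ (Even (i : ℕ) ↔ s)}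
  have hP : M.Definable L P := definable_pattern M φ _
  obtain ⟨t, ht⟩ := hU.exists_forall_mem hκ (mk_union_range_le hκ hM b) (ι := ι)
    (F := fun S => {t | t ∈ S.1 ∧ Sum.elim t b ∈ P})
    (fun S T => ⟨⟨S.1 ∩ T.1, S.2.1.inter T.2.1, S.2.2, T.2.2⟩,
      fun t ht => ⟨ht.1.1, ht.2⟩, fun t ht => ⟨ht.1.2, ht.2⟩⟩)
    (fun S => by
      refine (S.2.1.mono Set.subset_union_left).inter ?_
      have := definable_fiber (hP.preimage_comp Sum.swap) b (Set.subset_union_left)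
        (Set.subset_union_right (s := M))
      change (M ∪ Set.range b).Definable L {t | Sum.elim t b ∈ P}
      have e : ∀ t : Fin k × Fin m → U, Sum.elim t b = Sum.elim b t ∘ Sum.swap :=
        fun t => funext fun x => by cases x <;> rfl
      simp only [e]
      exact this)
    (fun S => by
      by_contra hne
      let Q : Set ((Fin n) ⊕ (Fin k × Fin m) → U) :=
        {v | v ∘ Sum.inr ∈ S.1} ∩ {v | v ∘ Sum.swap ∈ P}
      have hQ : M.Definable L Q := (S.2.1.preimage_comp Sum.inr).inter (hP.preimage_comp Sum.swap)
      have hQ' : ∀ (t : Fin k × Fin m → U) b', Sum.elim b' t ∈ Q ↔ t ∈ S.1 ∧ Sum.elim t b' ∈ P := by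
        intro t b'
        have : Sum.elim t b' = Sum.elim b' t ∘ Sum.swap := funext fun x => by cases x <;> rfl
        rw [this]
        rfl
      obtain ⟨b', hb', a', ha', hal⟩ := H _ hQ.exists_of_finite.compl
        (fun ⟨t, ht⟩ => hne ⟨t, (hQ' t b).1 ht⟩)
      exact hb' ⟨initTuple k a', (hQ' _ _).2 ⟨(ha' _ S.2.1).1 S.2.2, fun i => hal i i.2⟩⟩)
  refine ⟨fun i => if hi : i < k then fun j => t (⟨i, hi⟩, j) else a i, ?_, fun i hi => ?_⟩
  · refine SameDef.of_forall_imp fun S hS hv => ?_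
    have := (ht ⟨S, hS, hv⟩).1
    convert this using 1
    ext ⟨i, j⟩
    simp [initTuple]
  · have := (ht (Classical.arbitrary ι)).2 ⟨i, hi⟩
    simpa [hi] using this

/-- An invariant `φ`-type of a NIP formula is determined, on tuples of equal rank, by formulas over
the base, for a suitable upper semicontinuous rank. -/
theorem exists_rank {κ : Cardinal.{w}} (hκ : ℵ₀ ≤ κ)
    (hU : IsSaturated L U (Order.succ κ)) {φ : L.Formula (Fin m ⊕ Fin n)} (hφ : IsNIP U φ)
    {M : Set U} (hM : #M ≤ κ) {p : PhiType U φ} (hp : p ∈ Inv M φ) :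
    ∃ r : (Fin n → U) → ℕ, ∀ b, ∃ θ, M.Definable L θ ∧ b ∈ θ ∧
      ∀ b' ∈ θ, r b' ≤ r b ∧ (r b' = r b → (b' ∈ p.pos ↔ b ∈ p.pos)) := by
  classical
  obtain ⟨G, hG⟩ := p.exists_ultrafilter
  obtain ⟨A, a, hMA, ha⟩ := hU.exists_isGenericSeq hκ G hM
  obtain ⟨f, hf, K, hK⟩ := hφ.exists_strictMono_not_alternating hκ hU a
  have hA := ha.mono
  replace ha := ha.comp hf
  replace hMA : M ⊆ (A ∘ f) 0 := hMA.trans (hA (Nat.zero_le _))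
  change ∀ s b, ¬ ∀ i < K, φ.Realize (Sum.elim ((a ∘ f) i) b) ↔ (Even i ↔ s) at hK
  generalize A ∘ f = A' at ha hMA
  generalize a ∘ f = a at ha hK
  have hbound : ∀ b, ∃ k, ∀ s, ¬ Alternates M φ a k s b := by
    refine fun b => ⟨K, ?_⟩
    rintro s ⟨a', ha', hal⟩
    -- An alternation of `a'` at `b` becomes an alternation of `a` itself at a conjugate `b'`.
    obtain ⟨b', hb'⟩ := hU.exists_sameDef hκ hM ha'.symm b
    refine hK s b' fun i hi => ?_
    rw [← hal i hi]
    have h1 := hb'.realize_iff φ (Sum.map (fun j => (⟨i, hi⟩, j)) id)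
    have e1 : ∀ (a : ℕ → Fin m → U) (y : Fin n → U),
        Sum.elim (initTuple K a) y ∘ (Sum.map (fun j => (⟨i, hi⟩, j)) id :
          Fin m ⊕ Fin n → (Fin K × Fin m) ⊕ Fin n) = Sum.elim (a i) y :=
      fun a y => funext fun x => by cases x <;> rfl
    rw [e1, e1] at h1
    exact h1.symm
  -- `Even k ↔ s` is the value that would continue the alternation at position `k`. A next term with
  -- the value of `p` always exists, so that value must be the opposite one.
  have hval : ∀ k s b, Alternates M φ a k s b → ¬ Alternates M φ a (k + 1) s b →
      (b ∈ p.pos ↔ ¬ (Even k ↔ s)) := by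
    rintro k s b ⟨a', ha', hal⟩ hnot
    obtain ⟨c, hc, hcb⟩ := ha.exists_extension hκ hU hM hp hG hMA ha' b
    by_contra hne
    refine hnot ⟨_, hc, fun i hi => ?_⟩
    rcases (Nat.lt_succ_iff_lt_or_eq.1 hi) with hi | rfl
    · rw [Function.update_of_ne hi.ne, hal i hi]
    · rw [Function.update_self, hcb]
      tauto
  refine ⟨fun b => Nat.find (hbound b), fun b => ?_⟩
  have hspec := Nat.find_spec (hbound b)
  have hmin := fun k => Nat.find_min (hbound b) (m := k)
  generalize hJ : Nat.find (hbound b) = J at hspec hmin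
  cases J with
  | zero => exact absurd ⟨a, fun S _ => Iff.rfl, by simp⟩ (hspec True)
  | succ J =>
    obtain ⟨s, hs⟩ := not_forall_not.1 (hmin J J.lt_succ_self)
    -- Longest alternations in both phases would give `p` opposite values at `b`.
    have hs' : ¬ Alternates M φ a J (¬ s) b := fun h => by
      have h1 := hval J s b hs (hspec s)
      have h2 := hval J (¬ s) b h (hspec _)
      tauto
    obtain ⟨θ₁, hd₁, hb₁, hθ₁⟩ := exists_definable_not_alternates hκ hU hM (hspec s)
    obtain ⟨θ₂, hd₂, hb₂, hθ₂⟩ := exists_definable_not_alternates hκ hU hM (hspec (¬ s))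
    obtain ⟨θ₃, hd₃, hb₃, hθ₃⟩ := exists_definable_not_alternates hκ hU hM hs'
    have hcase : ∀ t : Prop, t = s ∨ t = ¬ s := fun t => by
      by_cases h : t ↔ s
      · exact Or.inl (propext h)
      · exact Or.inr (propext (by tauto))
    -- `θ₁` and `θ₂` bound the rank; `θ₃` excludes the other phase, and so fixes the value of `p`
    -- when the ranks agree.
    refine ⟨θ₁ ∩ θ₂ ∩ θ₃, (hd₁.inter hd₂).inter hd₃, ⟨⟨hb₁, hb₂⟩, hb₃⟩, ?_⟩
    rintro b' ⟨⟨h₁, h₂⟩, h₃⟩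
    have hnot : ∀ t, ¬ Alternates M φ a (J + 1) t b' := fun t => by
      rcases hcase t with rfl | rfl
      · exact hθ₁ b' h₁
      · exact hθ₂ b' h₂
    refine ⟨(Nat.find_min' (hbound b') hnot).trans hJ.ge, fun hr => ?_⟩
    replace hr : Nat.find (hbound b') = J + 1 := hr.trans hJ
    obtain ⟨t, ht⟩ := not_forall_not.1
      (Nat.find_min (hbound b') (m := J) (by rw [hr]; exact J.lt_succ_self))
    rcases hcase t with rfl | rfl
    · rw [hval J t b hs (hspec t), hval J t b' ht (hnot t)]
    · exact absurd ht (hθ₃ b' h₃)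

/-! ### Counting, closure, continuity points and limits -/

/-- The sets definable over a small set of parameters are few. -/
theorem mk_definable_le {κ : Cardinal.{w}} (hκ : ℵ₀ ≤ κ)
    (hL : Cardinal.lift.{w} L.card ≤ Cardinal.lift.{max u v} κ) {A : Set U} (hA : #A ≤ κ) (n : ℕ) :
    #{θ : Set (Fin n → U) // A.Definable L θ} ≤ κ := by
  have h1 : #(L[[A]].Formula (Fin n)) ≤ Cardinal.lift.{max u v} κ := by
    have h2 : #(L[[A]].Formula (Fin n)) ≤ #(Σ k, L[[A]].BoundedFormula (Fin n) k) :=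
      mk_le_of_injective (f := fun ψ => ⟨0, ψ⟩) fun ψ χ h => by simpa using h
    refine h2.trans (Language.BoundedFormula.card_le.trans (max_le (by simpa using hκ) ?_))
    rw [Language.card_withConstants]
    have hκ' : ℵ₀ ≤ Cardinal.lift.{max u v} κ := by simpa using hκ
    refine add_le_of_le hκ' ?_ ((lift_uzero _).trans_le (add_le_of_le hκ' hL ?_))
    · simpa using natCast_lt_aleph0.le.trans hκ'
    · simpa using hA
  have h3 : Function.Surjective (fun ψ : L[[A]].Formula (Fin n) =>
      (⟨Set.ofPred ψ.Realize, ψ, rfl⟩ : {θ : Set (Fin n → U) // A.Definable L θ})) := by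
    rintro ⟨_, ψ, rfl⟩
    exact ⟨ψ, rfl⟩
  have h4 := (lift_mk_le_lift_mk_of_surjective h3).trans (lift_le.2 h1)
  simpa using h4

/-- Indexing the parameters by `Fin N` leaves only countably many lengths and truth patterns to
treat. -/
theorem PhiType.mem_closure_iff {φ : L.Formula (Fin m ⊕ Fin n)} {p : PhiType U φ}
    {Z : Set (PhiType U φ)} :
    p ∈ closure Z ↔ ∀ (N : ℕ) (B : Fin N → Fin n → U), ∃ q ∈ Z, ∀ i, B i ∈ q.pos ↔ B i ∈ p.pos := by
  constructor
  · intro h N B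
    have ho : ∀ b : Fin n → U, IsOpen {q : PhiType U φ | b ∈ q.pos ↔ b ∈ p.pos} := fun b => by
      by_cases hb : b ∈ p.pos
      · simp only [hb, iff_true]
        exact TopologicalSpace.isOpen_generateFrom_of_mem (Or.inl ⟨b, rfl⟩)
      · simp only [hb, iff_false]
        exact TopologicalSpace.isOpen_generateFrom_of_mem (Or.inr ⟨b, rfl⟩)
    obtain ⟨q, hq, hqZ⟩ := _root_.mem_closure_iff.1 h _ (isOpen_iInter_of_finite fun i => ho (B i))
      (Set.mem_iInter.2 fun i => Iff.rfl)
    exact ⟨q, hqZ, Set.mem_iInter.1 hq⟩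
  · intro h
    rw [(TopologicalSpace.isTopologicalBasis_of_subbasis rfl).mem_closure_iff]
    rintro _ ⟨F, ⟨hF, hFs⟩, rfl⟩ hp
    have h1 : ∀ S ∈ F, ∃ b : Fin n → U, ∀ q : PhiType U φ, (b ∈ q.pos ↔ b ∈ p.pos) → q ∈ S := by
      intro S hS
      have hpS := hp S hS
      rcases hFs hS with ⟨b, rfl⟩ | ⟨b, rfl⟩
      · exact ⟨b, fun q hq => hq.2 hpS⟩
      · exact ⟨b, fun q hq => fun hb => hpS (hq.1 hb)⟩
    have := hF.to_subtype
    choose g hg using fun S : F => h1 S S.2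
    obtain ⟨N, ⟨e⟩⟩ := Finite.exists_equiv_fin F
    obtain ⟨q, hqZ, hq⟩ := h N (g ∘ e.symm)
    refine ⟨q, fun S hS => hg ⟨S, hS⟩ q ?_, hqZ⟩
    simpa using hq (e ⟨S, hS⟩)

/-- An invariant `φ`-type of a NIP formula, as a function on tuples of parameters, has a point of
continuity on every nonempty set, with respect to the topology given by the formulas over the
base. -/
theorem exists_continuity_point {κ : Cardinal.{w}} (hκ : ℵ₀ ≤ κ)
    (hU : IsSaturated L U (Order.succ κ)) {φ : L.Formula (Fin m ⊕ Fin n)} (hφ : IsNIP U φ)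
    {M : Set U} (hM : #M ≤ κ) {p : PhiType U φ} (hp : p ∈ Inv M φ) {N : ℕ}
    {D : Set (Fin N → Fin n → U)} (hD : D.Nonempty) :
    ∃ B ∈ D, ∃ θ : Fin N → {θ : Set (Fin n → U) // M.Definable L θ}, (∀ i, B i ∈ (θ i).1) ∧
      ∀ B' ∈ D, (∀ i, B' i ∈ (θ i).1) → ∀ i, B' i ∈ p.pos ↔ B i ∈ p.pos := by
  obtain ⟨r, hr⟩ := exists_rank hκ hU hφ hM hp
  choose θ hd hb hθ using hr
  -- Near a point of minimal total rank no single rank can increase, hence none can decrease within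
  -- `D`, and all ranks are equal.
  obtain ⟨B, hB, hmin⟩ := exists_minimalFor_of_wellFoundedLT (· ∈ D) (fun B => ∑ i, r (B i)) hD
  refine ⟨B, hB, fun i => ⟨θ (B i), hd _⟩, fun i => hb _, fun B' hB' h => ?_⟩
  have hle : ∀ i, r (B' i) ≤ r (B i) := fun i => (hθ _ _ (h i)).1
  have heq := (Finset.sum_eq_sum_iff_of_le fun i _ => hle i).1
    (le_antisymm (Finset.sum_le_sum fun i _ => hle i) (hmin hB' (Finset.sum_le_sum fun i _ => hle i)))
  exact fun i => (hθ _ _ (h i)).2 (heq i (Finset.mem_univ i))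

/-- The limit of a family of `φ`-types along an ultrafilter. -/
def PhiType.lim {φ : L.Formula (Fin m ⊕ Fin n)} {ι : Type*} (V : Ultrafilter ι)
    (f : ι → PhiType U φ) : PhiType U φ where
  pos := {b | ∀ᶠ e in V, b ∈ (f e).pos}
  consistent s := by
    have h : ∀ᶠ e in V, ∀ b ∈ s, (b ∈ (f e).pos ↔ ∀ᶠ e in V, b ∈ (f e).pos) := by
      refine (Filter.eventually_all_finset s).2 fun b _ => ?_
      by_cases hb : ∀ᶠ e in V, b ∈ (f e).pos
      · simp only [hb, iff_true]
      · simp only [hb, iff_false]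
        exact Ultrafilter.eventually_not.2 hb
    obtain ⟨e, he⟩ := h.exists
    obtain ⟨a, ha⟩ := (f e).consistent s
    exact ⟨a, fun b hb => (ha b hb).trans (he b hb)⟩

theorem PhiType.mem_lim {φ : L.Formula (Fin m ⊕ Fin n)} {ι : Type*} {V : Ultrafilter ι}
    {f : ι → PhiType U φ} {b : Fin n → U} : b ∈ (lim V f).pos ↔ ∀ᶠ e in V, b ∈ (f e).pos :=
  Iff.rfl

theorem PhiType.lim_mem_inv {φ : L.Formula (Fin m ⊕ Fin n)} {ι : Type*} {V : Ultrafilter ι}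
    {f : ι → PhiType U φ} {A : Set U} (hf : ∀ e, f e ∈ Inv A φ) : lim V f ∈ Inv A φ :=
  fun b b' h => Filter.eventually_congr (Filter.Eventually.of_forall fun e => hf e b b' h)

theorem PhiType.agrees_lim_iff {φ : L.Formula (Fin m ⊕ Fin n)} {ι : Type*} {V : Ultrafilter ι}
    {f : ι → PhiType U φ} {N : ℕ} {B : Fin N → Fin n → U} {η : Fin N → Prop} :
    (∀ i, B i ∈ (lim V f).pos ↔ η i) ↔ ∀ᶠ e in V, ∀ i, B i ∈ (f e).pos ↔ η i := by
  rw [Filter.eventually_all]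
  refine forall_congr' fun i => ?_
  by_cases h : η i
  · simp [h, mem_lim]
  · simpa only [h, iff_false, mem_lim] using Ultrafilter.eventually_not.symm

/-! ### The small subset of Z -/

/-- A small subset of `Z` suffices to agree with `p` on each of the `N`-tuples of parameters at which
`p` takes the values `η`. -/
theorem exists_small_agreeing {κ : Cardinal.{w}} (hκ : ℵ₀ ≤ κ)
    (hL : Cardinal.lift.{w} L.card ≤ Cardinal.lift.{max u v} κ)
    (hU : IsSaturated L U (Order.succ κ)) {φ : L.Formula (Fin m ⊕ Fin n)} (hφ : IsNIP U φ)
    {M : Set U} (hM : #M ≤ κ) {Z : Set (PhiType U φ)} (hZ : Z ⊆ Inv M φ) {p : PhiType U φ}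
    (hp : p ∈ closure Z) (N : ℕ) (η : Fin N → Prop) :
    ∃ Z₀ ⊆ Z, #Z₀ ≤ κ ∧ ∀ B : Fin N → Fin n → U, (∀ i, B i ∈ p.pos ↔ η i) →
      ∃ q ∈ Z₀, ∀ i, B i ∈ q.pos ↔ η i := by
  classical
  let Bad : Set (PhiType U φ) → Set (Fin N → Fin n → U) := fun Y =>
    {B | (∀ i, B i ∈ p.pos ↔ η i) ∧ ∀ q ∈ Y, ¬ ∀ i, B i ∈ q.pos ↔ η i}
  let O := Fin N → {θ : Set (Fin n → U) // M.Definable L θ}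
  have hO : #O ≤ κ := by
    have h := mk_definable_le hκ hL hM n
    simp only [O, mk_pi, prod_const, mk_fin, lift_natCast, lift_uzero]
    exact (power_le_power_right h).trans (power_nat_le hκ)
  let nbd : O → Set (Fin N → Fin n → U) := fun θ => {B | ∀ i, B i ∈ (θ i).1}
  -- `Y θ` clears `nbd θ` of bad points if a small subset of `Z` can do so; otherwise it is empty.
  have hY : ∀ θ : O, ∃ Y ⊆ Z, #Y ≤ κ ∧
      ((∃ Y' ⊆ Z, #Y' ≤ κ ∧ Disjoint (Bad Y') (nbd θ)) → Disjoint (Bad Y) (nbd θ)) := fun θ => by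
    by_cases h : ∃ Y' ⊆ Z, #Y' ≤ κ ∧ Disjoint (Bad Y') (nbd θ)
    · obtain ⟨Y, h1, h2, h3⟩ := h
      exact ⟨Y, h1, h2, fun _ => h3⟩
    · exact ⟨∅, Set.empty_subset _, by simp, fun h' => absurd h' h⟩
  choose Y hYZ hYκ hY using hY
  have hBad : ∀ {Y Y' : Set (PhiType U φ)}, Y ⊆ Y' → Bad Y' ⊆ Bad Y :=
    fun h B hB => ⟨hB.1, fun q hq => hB.2 q (h hq)⟩
  have hZ₀κ : #(⋃ θ, Y θ : Set (PhiType U φ)) ≤ κ := by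
    exact (mk_iUnion_le Y).trans (mul_le_of_le hκ hO (ciSup_le' hYκ))
  refine ⟨⋃ θ, Y θ, Set.iUnion_subset hYZ, hZ₀κ, ?_⟩
  by_contra! hcon
  have hD : (Bad (⋃ θ, Y θ)).Nonempty := by
    obtain ⟨B, hB, hB'⟩ := hcon
    refine ⟨B, hB, fun q hq h => ?_⟩
    obtain ⟨i, hi⟩ := hB' q hq
    have := h i
    tauto
  set Z₀ := ⋃ θ, Y θ
  set D := Bad Z₀
  have hdense : ∀ Y' ⊆ Z, #Y' ≤ κ → ∀ θ : O, (D ∩ nbd θ).Nonempty → (Bad Y' ∩ nbd θ).Nonempty := by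
    intro Y' hY' hκ' θ hne
    by_contra hemp
    have hdis := hY θ ⟨Y', hY', hκ', Set.disjoint_iff_inter_eq_empty.2
      (Set.not_nonempty_iff_eq_empty.1 hemp)⟩
    obtain ⟨B, hB, hBθ⟩ := hne
    exact hdis.le_bot ⟨hBad (Set.subset_iUnion Y θ) hB, hBθ⟩
  let O' := {θ : O // (D ∩ nbd θ).Nonempty}
  have hO' : #O' ≤ κ := (mk_subtype_le _).trans hO
  choose E hE using fun θ : O' => θ.2
  have hag : ∀ s : Finset O', ∃ q ∈ Z, ∀ θ ∈ s, ∀ i, E θ i ∈ q.pos ↔ η i := by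
    intro s
    obtain ⟨K, ⟨e⟩⟩ := Finite.exists_equiv_fin (s × Fin N)
    obtain ⟨q, hqZ, hq⟩ := PhiType.mem_closure_iff.1 hp K
      (fun k => E (e.symm k).1 (e.symm k).2)
    refine ⟨q, hqZ, fun θ hθ i => ?_⟩
    have := hq (e (⟨θ, hθ⟩, i))
    simp only [Equiv.symm_apply_apply] at this
    exact this.trans ((hE θ).1.1 i)
  choose f hfZ hf using hag
  let Z₁ := Z₀ ∪ Set.range f
  have hZ₁ : Z₁ ⊆ Z := Set.union_subset (Set.iUnion_subset hYZ) (Set.range_subset_iff.2 hfZ)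
  have hZ₁κ : #Z₁ ≤ κ := by
    refine (mk_union_le _ _).trans (add_le_of_le hκ hZ₀κ (mk_range_le.trans ?_))
    rcases finite_or_infinite O' with h | h
    · exact mk_le_aleph0.trans hκ
    · exact (mk_finset_of_infinite O').trans_le hO'
  -- `V` refines `atTop`, so every given `θ` lies in almost all finite sets.
  let V : Ultrafilter (Finset O') := Ultrafilter.of Filter.atTop
  let g := PhiType.lim V f
  have hgE : ∀ θ : O', ∀ i, E θ i ∈ g.pos ↔ η i := fun θ => by
    refine PhiType.agrees_lim_iff.2 (Ultrafilter.of_le _ ?_)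
    filter_upwards [Filter.eventually_ge_atTop {θ}] with s hs
    exact hf s θ (hs (Finset.mem_singleton_self θ))
  have hgBad : ∀ B ∈ Bad Z₁, ¬ ∀ i, B i ∈ g.pos ↔ η i := by
    intro B hB h
    obtain ⟨e, he⟩ := (PhiType.agrees_lim_iff.1 h).exists
    exact hB.2 _ (Or.inr ⟨e, rfl⟩) he
  obtain ⟨B, hB, θ, hBθ, hcont⟩ := exists_continuity_point hκ hU hφ hM
    (PhiType.lim_mem_inv (V := V) fun e => hZ (hfZ e)) hD
  have hne : (D ∩ nbd θ).Nonempty := ⟨B, hB, hBθ⟩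
  obtain ⟨B', hB', hB'θ⟩ := hdense Z₁ hZ₁ hZ₁κ θ hne
  -- Near the continuity point `B`, `g` would have the same pattern at the picked point, where it is
  -- η, and at `B'`, where it is not.
  have h1 := hcont (E ⟨θ, hne⟩) (hE ⟨θ, hne⟩).1 (hE ⟨θ, hne⟩).2
  have h2 := hcont B' (hBad Set.subset_union_left hB') hB'θ
  exact hgBad B' hB' fun i => (h2 i).trans ((h1 i).symm.trans (hgE _ i))

end LocalType


/-- The small sets for the countably many pairs of a length and a pattern are united. -/
theorem mainTheorem9 {L : FirstOrder.Language.{u, v}} {U : Type w} [L.Structure U]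
    (κ : Cardinal.{w}) (hκ : ℵ₀ ≤ κ)
    (hL : Cardinal.lift.{w} L.card ≤ Cardinal.lift.{max u v} κ)
    (hU : LocalType.IsSaturated L U (Order.succ κ))
    (M : L.ElementarySubstructure U) (hM : #M ≤ κ)
    {m n : ℕ} (φ : L.Formula (Fin m ⊕ Fin n)) (hφ : LocalType.IsNIP U φ)
    (Z : Set (LocalType.PhiType U φ)) (hZ : Z ⊆ LocalType.Inv (M : Set U) φ)
    (p : LocalType.PhiType U φ) (hp : p ∈ closure Z) :
    ∃ Z₀ ⊆ Z, #Z₀ ≤ κ ∧ p ∈ closure Z₀ := by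
  choose Y hYZ hYκ hY using fun x : (N : ℕ) × (Fin N → Prop) =>
    LocalType.exists_small_agreeing hκ hL hU hφ hM hZ hp x.1 x.2
  refine ⟨⋃ x, Y x, Set.iUnion_subset hYZ, ?_, LocalType.PhiType.mem_closure_iff.2 fun N B => ?_⟩
  · have h := mk_iUnion_le_lift Y
    simp only [lift_uzero] at h
    refine h.trans (mul_le_of_le hκ ?_ (ciSup_le' hYκ))
    exact (lift_le_aleph0.2 mk_le_aleph0).trans hκ
  · obtain ⟨q, hq, h⟩ := hY ⟨N, fun i => B i ∈ p.pos⟩ B fun i => Iff.rfl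
    exact ⟨q, Set.mem_iUnion.2 ⟨_, hq⟩, h⟩
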